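/- Let $\mathbb{H}$ be Philip Hall's universal locally finite group, that is, the countable locally finite group, unique up to isomorphism, such that (i) every finite group embeds in $\mathbb{H}$, and (ii) any two isomorphic finite subgroups of $\mathbb{H}$ are conjugate in $\mathbb{H}$. Equip $\mathrm{Aut}(\mathbb{H})$ with the topology of pointwise convergence, i.e. the subspace topology inherited from the product topology on $\mathbb{H}^{\mathbb{H}}$ with $\mathbb{H}$ discrete. Call $g\in\mathrm{Aut}(\mathbb{H})$ generic if its conjugacy class in $\mathrm{Aut}(\mathbb{H})$ is comeager, i.e. contains a countable intersection of dense open subsets of $\mathrm{Aut}(\mathbb{H})$. Then for every generic $g\in\mathrm{Aut}(\mathbb{H})$ and every integer $n\ge 1$, the automorphisms $g$ and $g^n$ are conjugate in $\mathrm{Aut}(\mathbb{H})$. -/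

import Mathlib

/-- A group is locally finite if each of its finitely generated subgroups is finite. -/
def IsLocallyFiniteGroup (G : Type*) [Group G] : Prop :=
  ∀ K : Subgroup G, K.FG → Finite K

/-- `G` is (isomorphic to) Philip Hall's universal group: a countable locally finite group in which
every finite group embeds and in which isomorphic finite subgroups are conjugate. These properties
determine `G` up to isomorphism, and `G` is infinite because arbitrarily large finite groups embed
in it. Every finite group is isomorphic to one whose carrier lies in `Type`, so it is enough to
quantify over those. -/
structure IsHallUniversalGroup (G : Type*) [Group G] : Prop where
  countable : Countable G
  locallyFinite : IsLocallyFiniteGroup G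
  embeds : ∀ (F : Type) [Group F] [Finite F], ∃ f : F →* G, Function.Injective f
  conjugate : ∀ K L : Subgroup G, Finite K → Finite L → Nonempty (K ≃* L) →
    ∃ g : G, K.map (MulAut.conj g).toMonoidHom = L

/-- The topology of pointwise convergence on `Aut(G)`, for `G` discrete: the subspace topology
inherited from the product topology on `G → G`. -/
abbrev autTopology (G : Type*) [Group G] : TopologicalSpace (MulAut G) :=
  TopologicalSpace.induced (fun (g : MulAut G) (x : G) => g x)
    (@Pi.topologicalSpace G (fun _ => G) (fun _ => ⊥))

/-- An automorphism is generic if its conjugacy class in `Aut(G)` is comeager, that is, contains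
a countable intersection of dense open sets. -/
def IsGenericAut {G : Type*} [Group G] (g : MulAut G) : Prop :=
  {h : MulAut G | IsConj g h} ∈ @residual (MulAut G) (autTopology G)

section

open Subgroup

variable {H : Type*} [Group H]

/-! Genericity is replaced by the combinatorial notion `IsUniversalAut`. A back-and-forth makes any
two universal automorphisms conjugate (`IsUniversalAut.isConj`). Universality is a countable
conjunction of dense open conditions, so by Baire category every generic class contains a universal
`g'`. It then suffices that `g' ^ n` is universal (`IsUniversalAut.pow`).

The crux is `exists_amalgam_root`: an extension `s` of a finite restriction of `g ^ n` must come
from an `n`-th power. If `g` acts as `t`, multiplying `s` and `t` by centralising elements of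
suitable orders makes `s` and `t ^ n` conjugate over the common subgroup; universality of `g` then
realises the modified `t`. -/

theorem IsLocallyFiniteGroup.finite_closure (hH : IsLocallyFiniteGroup H) {S : Set H}
    (hS : S.Finite) : Finite (closure S) :=
  hH _ ((Subgroup.fg_iff _).2 ⟨S, rfl, hS⟩)

theorem IsLocallyFiniteGroup.orderOf_pos (hH : IsLocallyFiniteGroup H) (x : H) :
    0 < orderOf x := by
  have := hH.finite_closure (Set.finite_singleton x)
  have h := _root_.orderOf_pos (⟨x, Subgroup.subset_closure rfl⟩ : closure {x})
  rwa [Subgroup.orderOf_mk] at h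

/-! ### Homogeneity of Hall's group -/

/-- Two embeddings of a finite group agree up to an automorphism of the source and an inner
automorphism of the target. -/
theorem IsHallUniversalGroup.exists_conj_mulEquiv (hH : IsHallUniversalGroup H) {K : Type*}
    [Group K] [Finite K] (φ ψ : K →* H) (hφ : Function.Injective φ) (hψ : Function.Injective ψ) :
    ∃ (g : H) (α : K ≃* K), ∀ k, φ k = g * ψ (α k) * g⁻¹ := by
  obtain ⟨g, hg⟩ := hH.conjugate ψ.range φ.range
    (Finite.of_surjective _ ψ.rangeRestrict_surjective)
    (Finite.of_surjective _ φ.rangeRestrict_surjective)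
    ⟨(MonoidHom.ofInjective hψ).symm.trans (MonoidHom.ofInjective hφ)⟩
  have key : ∀ k, ∃ k', φ k = g * ψ k' * g⁻¹ := by
    intro k
    have : φ k ∈ φ.range := ⟨k, rfl⟩
    rw [← hg] at this
    obtain ⟨_, ⟨k', rfl⟩, h⟩ := this
    exact ⟨k', by simpa using h.symm⟩
  choose a ha using key
  have hmul : ∀ x y, a (x * y) = a x * a y := by
    intro x y
    apply hψ
    have h := ha (x * y)
    rw [map_mul φ, ha x, ha y] at h
    rw [map_mul]
    have h2 : g * ψ (a (x * y)) * g⁻¹ = g * (ψ (a x) * ψ (a y)) * g⁻¹ := by rw [← h]; group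
    exact mul_left_cancel (mul_right_cancel h2)
  have hinj : Function.Injective a := fun x y h => hφ (by rw [ha, ha y, h])
  exact ⟨g, MulEquiv.ofBijective (MonoidHom.mk' a hmul) (Finite.injective_iff_bijective.1 hinj), ha⟩

theorem IsHallUniversalGroup.exists_embedding (hH : IsHallUniversalGroup H) (K : Type*) [Group K]
    [Finite K] : ∃ f : K →* H, Function.Injective f := by
  have : Small.{0} K := Countable.toSmall K
  have : Finite (Shrink.{0} K) := Finite.of_equiv K (equivShrink K)
  obtain ⟨f, hf⟩ := hH.embeds (Shrink.{0} K)
  exact ⟨f.comp (Shrink.mulEquiv.{0} (α := K)).symm.toMonoidHom, hf.comp (MulEquiv.injective _)⟩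

/-- Every automorphism of a finite group embedded in `H` is realised by conjugation. -/
theorem IsHallUniversalGroup.exists_conj_eq_mulAut (hH : IsHallUniversalGroup H) {K : Type*}
    [Group K] [Finite K] (ψ : K →* H) (hψ : Function.Injective ψ) (α : K ≃* K) :
    ∃ g : H, ∀ k, ψ (α k) = g * ψ k * g⁻¹ := by
  obtain ⟨f, hf⟩ := hH.exists_embedding (Equiv.Perm K)
  -- In the left regular representation every automorphism of `K` is conjugation by a permutation.
  -- The twist `β` is absorbed by conjugating `α` with it.
  let l : K →* Equiv.Perm K := MulAction.toPermHom K K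
  have hl : Function.Injective l := MulAction.toPerm_injective
  obtain ⟨u, β, hβ⟩ := hH.exists_conj_mulEquiv ψ (f.comp l) hψ (hf.comp hl)
  let π : Equiv.Perm K := (β.symm.trans (α.trans β)).toEquiv
  have hπ : ∀ k, l (β (α k)) = π * l (β k) * π⁻¹ := by
    intro k
    ext x
    simp [l, π, Equiv.Perm.mul_apply, Equiv.Perm.inv_def]
  refine ⟨u * f π * u⁻¹, fun k => ?_⟩
  rw [hβ, hβ k]
  simp only [MonoidHom.comp_apply, hπ, map_mul, map_inv]
  group

/-- Any two embeddings of a finite group differ by an inner automorphism. -/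
theorem IsHallUniversalGroup.exists_conj_eq (hH : IsHallUniversalGroup H) {K : Type*}
    [Group K] [Finite K] (φ ψ : K →* H) (hφ : Function.Injective φ) (hψ : Function.Injective ψ) :
    ∃ g : H, ∀ k, φ k = g * ψ k * g⁻¹ := by
  obtain ⟨g, α, h⟩ := hH.exists_conj_mulEquiv φ ψ hφ hψ
  obtain ⟨u, hu⟩ := hH.exists_conj_eq_mulAut ψ hψ α
  exact ⟨g * u, fun k => by rw [h, hu]; group⟩

/-- Every automorphism agrees with an inner one on any finite set. -/
theorem IsHallUniversalGroup.exists_conj_eq_on (hH : IsHallUniversalGroup H) (g : MulAut H)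
    (F : Finset H) : ∃ s : H, ∀ x ∈ F, g x = s * x * s⁻¹ := by
  have := hH.locallyFinite.finite_closure F.finite_toSet
  obtain ⟨s, hs⟩ := hH.exists_conj_eq (g.toMonoidHom.comp (closure (F : Set H)).subtype)
    (closure (F : Set H)).subtype (g.injective.comp Subtype.val_injective) Subtype.val_injective
  exact ⟨s, fun x hx => hs ⟨x, Subgroup.subset_closure hx⟩⟩

/-- A finite subgroup is centralised by an element of any prescribed order which generates a
cyclic group meeting it trivially. -/
theorem IsHallUniversalGroup.exists_commute_orderOf (hH : IsHallUniversalGroup H) (E : Subgroup H)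
    [Finite E] {m : ℕ} (hm : 0 < m) :
    ∃ z : H, (∀ x ∈ E, Commute z x) ∧ orderOf z = m ∧ ∀ i : ℤ, z ^ i ∈ E → z ^ i = 1 := by
  have : NeZero m := ⟨hm.ne'⟩
  obtain ⟨f, hf⟩ := hH.exists_embedding (E × Multiplicative (ZMod m))
  have hinl : Function.Injective (MonoidHom.inl E (Multiplicative (ZMod m))) :=
    fun a b h => congrArg Prod.fst h
  obtain ⟨g, hg⟩ := hH.exists_conj_eq E.subtype (f.comp (MonoidHom.inl E _))
    Subtype.val_injective (hf.comp hinl)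
  let F : E × Multiplicative (ZMod m) →* H := (MulAut.conj g).toMonoidHom.comp f
  have hF : Function.Injective F := (MulAut.conj g).injective.comp hf
  have hE : ∀ x : E, F (x, 1) = x := fun x => by simpa [F] using (hg x).symm
  let c : E × Multiplicative (ZMod m) := (1, Multiplicative.ofAdd 1)
  refine ⟨F c, fun x hx => ?_, ?_, fun i hi => ?_⟩
  · rw [show x = F (⟨x, hx⟩, 1) from (hE ⟨x, hx⟩).symm]
    exact Commute.map (by simp [c, Commute, SemiconjBy]) F
  · rw [orderOf_injective F hF, Prod.orderOf]
    simp [c]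
  · have h : F (c ^ i) = F (⟨_, hi⟩, 1) := by rw [hE, map_zpow]
    have h2 := congrArg Prod.snd (hF h)
    have h3 : c ^ i = 1 := Prod.ext (by simp [c]) (by simpa using h2)
    rw [← map_zpow, h3, map_one]

theorem Subgroup.exists_mul_zpow_of_mem_closure {G : Type*} [Group G] {K : Subgroup G} {u : G}
    (hu : u ∈ normalizer (K : Set G)) {x : G} (hx : x ∈ closure ((K : Set G) ∪ {u})) :
    ∃ k ∈ K, ∃ i : ℤ, x = k * u ^ i := by
  have hz : ∀ i : ℤ, ∀ k ∈ K, u ^ i * k * (u ^ i)⁻¹ ∈ K := fun i k hk =>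
    (mem_normalizer_iff.1 (zpow_mem hu i) k).1 hk
  induction hx using closure_induction with
  | mem x hx =>
    rcases hx with hx | rfl
    · exact ⟨x, hx, 0, by simp⟩
    · exact ⟨1, one_mem _, 1, by simp⟩
  | one => exact ⟨1, one_mem _, 0, by simp⟩
  | mul x y _ _ hx hy =>
    obtain ⟨k, hk, i, rfl⟩ := hx
    obtain ⟨l, hl, j, rfl⟩ := hy
    exact ⟨k * (u ^ i * l * (u ^ i)⁻¹), mul_mem hk (hz i l hl), i + j, by rw [zpow_add]; group⟩
  | inv x _ hx =>
    obtain ⟨k, hk, i, rfl⟩ := hx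
    exact ⟨_, hz (-i) _ (inv_mem hk), -i, by group⟩

/-! ### Amalgamation and roots -/

/-- Elements acting in the same way on a finite subgroup, with cyclic groups of the same order
meeting it trivially, are conjugate over that subgroup. -/
theorem IsHallUniversalGroup.exists_conj_of_same_action (hH : IsHallUniversalGroup H)
    (K : Subgroup H) [Finite K] {s t : H} (hs : ∀ k ∈ K, s * k * s⁻¹ ∈ K)
    (hst : ∀ k ∈ K, s * k * s⁻¹ = t * k * t⁻¹)
    (h₁ : ∀ i : ℤ, s ^ i ∈ K → t ^ i = 1) (h₂ : ∀ i : ℤ, t ^ i ∈ K → s ^ i = 1) :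
    ∃ h : H, (∀ k ∈ K, h * k * h⁻¹ = k) ∧ h * s * h⁻¹ = t := by
  let d : H →* H × H := (MonoidHom.id H).prod (MonoidHom.id H)
  let D : Subgroup (H × H) := K.map d
  let u : H × H := (s, t)
  have : Finite D := ((Set.toFinite (K : Set H)).image d).to_subtype
  have hu : u ∈ normalizer (D : Set (H × H)) := by
    have : Finite (D : Set (H × H)) := ‹Finite D›
    refine mem_normalizer_fintype ?_
    rintro _ ⟨k, hk, rfl⟩
    exact ⟨s * k * s⁻¹, hs k hk, Prod.ext (by simp [u, d]) (by simp [u, d, hst k hk])⟩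
  -- `N` is the graph of an isomorphism from ⟨K, s⟩ to ⟨K, t⟩ fixing `K`: `h₁` and `h₂` make both
  -- projections injective.
  let N : Subgroup (H × H) := closure ((D : Set (H × H)) ∪ {u})
  have hN : ∀ x ∈ N, ∃ k ∈ K, ∃ i : ℤ, x = (k * s ^ i, k * t ^ i) := by
    intro x hx
    obtain ⟨_, ⟨k, hk, rfl⟩, i, rfl⟩ := exists_mul_zpow_of_mem_closure hu hx
    exact ⟨k, hk, i, rfl⟩
  have mem_of : ∀ {k y : H}, k ∈ K → k * y = 1 → y ∈ K := fun hk h => by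
    rw [eq_inv_of_mul_eq_one_right h]; exact inv_mem hk
  let p : N →* H := (MonoidHom.fst H H).comp N.subtype
  let q : N →* H := (MonoidHom.snd H H).comp N.subtype
  have hp : Function.Injective p := by
    rw [injective_iff_map_eq_one]
    rintro ⟨x, hx⟩ h1
    obtain ⟨k, hk, i, rfl⟩ := hN x hx
    have h1 : k * s ^ i = 1 := h1
    have ht := h₁ i (mem_of hk h1)
    have hs' := h₂ i (ht ▸ one_mem K)
    rw [hs', mul_one] at h1
    ext <;> simp [hs', ht, h1]
  have hq : Function.Injective q := by
    rw [injective_iff_map_eq_one]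
    rintro ⟨x, hx⟩ h1
    obtain ⟨k, hk, i, rfl⟩ := hN x hx
    have h1 : k * t ^ i = 1 := h1
    have hs' := h₂ i (mem_of hk h1)
    have ht := h₁ i (hs' ▸ one_mem K)
    rw [ht, mul_one] at h1
    ext <;> simp [hs', ht, h1]
  have : Finite N := by
    have := hH.locallyFinite.finite_closure (S := (K : Set H) ∪ {s})
      ((Set.toFinite (K : Set H)).union (Set.finite_singleton s))
    refine Finite.of_injective (β := closure ((K : Set H) ∪ {s})) (fun x => ⟨p x, ?_⟩)
      fun x y h => hp (congrArg Subtype.val h)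
    obtain ⟨k, hk, i, hx⟩ := hN x x.2
    have : p x = k * s ^ i := congrArg Prod.fst hx
    rw [this]
    have hs' : s ∈ closure ((K : Set H) ∪ {s}) := Subgroup.subset_closure (Or.inr rfl)
    exact mul_mem (Subgroup.subset_closure (Or.inl hk)) (zpow_mem hs' i)
  obtain ⟨h, hh⟩ := hH.exists_conj_eq q p hq hp
  refine ⟨h, fun k hk => ?_, ?_⟩
  · exact (hh ⟨d k, Subgroup.subset_closure (Or.inl ⟨k, hk, rfl⟩)⟩).symm
  · exact (hh ⟨u, Subgroup.subset_closure (Or.inr rfl)⟩).symm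

/-- Amalgamation with extraction of roots: if `s` and `t ^ n` act in the same way on `K`, then
after moving the data for `s` by an element centralising `K`, both actions are induced by one
element `t'` and its `n`-th power. -/
theorem IsHallUniversalGroup.exists_amalgam_root (hH : IsHallUniversalGroup H) (K E M : Finset H)
    {s t : H} {n : ℕ} (hn : 0 < n) (hK : ∀ k ∈ K, s * k * s⁻¹ ∈ K)
    (hst : ∀ k ∈ K, s * k * s⁻¹ = t ^ n * k * (t ^ n)⁻¹) :
    ∃ t' h : H, (∀ x ∈ E, t' * x * t'⁻¹ = t * x * t⁻¹) ∧ (∀ k ∈ K, h * k * h⁻¹ = k) ∧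
      ∀ m ∈ M, t' ^ n * (h * m * h⁻¹) * (t' ^ n)⁻¹ = h * (s * m * s⁻¹) * h⁻¹ := by
  let K' := closure (K : Set H)
  let E' := closure ((K : Set H) ∪ E ∪ {t})
  let M' := closure ((K : Set H) ∪ M ∪ {s})
  have : Finite K' := hH.locallyFinite.finite_closure K.finite_toSet
  have : Finite E' := hH.locallyFinite.finite_closure (by simp)
  have : Finite M' := hH.locallyFinite.finite_closure (by simp)
  have hKE : K' ≤ E' := closure_mono fun x hx => Or.inl (Or.inl hx)
  have hKM : K' ≤ M' := closure_mono fun x hx => Or.inl (Or.inl hx)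
  have htE : t ∈ E' := Subgroup.subset_closure (Or.inr rfl)
  have hsM : s ∈ M' := Subgroup.subset_closure (Or.inr rfl)
  -- Both `s ^ m` and `t ^ m` are trivial. Giving `w` order `m` and `z` order `n * m` makes `w` and
  -- `z ^ n` both of order `m`, so `s * w` and `(t * z) ^ n` enter `K'` only at multiples of `m`,
  -- where both vanish.
  set m := orderOf s * orderOf t with hm
  have hm0 : 0 < m := Nat.mul_pos (hH.locallyFinite.orderOf_pos s) (hH.locallyFinite.orderOf_pos t)
  obtain ⟨z, hzE, hzo, hz1⟩ := hH.exists_commute_orderOf E' (Nat.mul_pos hn hm0)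
  obtain ⟨w, hwM, hwo, hw1⟩ := hH.exists_commute_orderOf M' hm0
  have hsw : ∀ i : ℤ, (s * w) ^ i = s ^ i * w ^ i := (hwM s hsM).symm.mul_zpow
  have htz : ∀ i : ℤ, ((t * z) ^ n) ^ i = t ^ (n * i) * z ^ (n * i) := fun i => by
    rw [← zpow_natCast, ← zpow_mul, (hzE t htE).symm.mul_zpow]
  have hw : ∀ x ∈ M', (s * w) * x * (s * w)⁻¹ = s * x * s⁻¹ := fun x hx => by
    rw [mul_assoc s w, (hwM x hx).eq]; group
  have hz : ∀ x ∈ E', (t * z) * x * (t * z)⁻¹ = t * x * t⁻¹ := fun x hx => by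
    rw [mul_assoc t z, (hzE x hx).eq]; group
  have hzn : ∀ x ∈ E', (t * z) ^ n * x * ((t * z) ^ n)⁻¹ = t ^ n * x * (t ^ n)⁻¹ := fun x hx => by
    rw [(hzE t htE).symm.mul_pow, mul_assoc (t ^ n), ((hzE x hx).pow_left n).eq]; group
  have hs0 : ∀ i : ℤ, (m : ℤ) ∣ i → s ^ i = 1 := fun i hi =>
    orderOf_dvd_iff_zpow_eq_one.1 ((Dvd.intro _ (by rw [hm]; push_cast; rfl)).trans hi)
  have ht0 : ∀ i : ℤ, (m : ℤ) ∣ i → t ^ i = 1 := fun i hi =>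
    orderOf_dvd_iff_zpow_eq_one.1 ((Dvd.intro_left _ (by rw [hm]; push_cast; rfl)).trans hi)
  have hw0 : ∀ i : ℤ, w ^ i = 1 ↔ (m : ℤ) ∣ i := fun i => by
    rw [← hwo, orderOf_dvd_iff_zpow_eq_one]
  have hz0 : ∀ i : ℤ, z ^ (n * i) = 1 ↔ (m : ℤ) ∣ i := fun i => by
    rw [← orderOf_dvd_iff_zpow_eq_one, hzo, Nat.cast_mul]
    exact mul_dvd_mul_iff_left (by exact_mod_cast hn.ne')
  have hact : ∀ k ∈ K', s * k * s⁻¹ = t ^ n * k * (t ^ n)⁻¹ := fun k hk =>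
    (MonoidHom.eqOn_closure (f := (MulAut.conj s).toMonoidHom)
      (g := (MulAut.conj (t ^ n)).toMonoidHom) (s := K) fun x hx => by
        simpa only [MulEquiv.toMonoidHom_eq_coe, MonoidHom.coe_coe, MulAut.conj_apply] using hst x hx) hk
  have hinv : ∀ k ∈ K', s * k * s⁻¹ ∈ K' := fun k hk => by
    have : K' ≤ K'.comap (MulAut.conj s).toMonoidHom :=
      (closure_le _).2 fun x hx => Subgroup.subset_closure (by simpa using hK x hx)
    exact this hk
  obtain ⟨h, hh, hc⟩ := hH.exists_conj_of_same_action K' (s := s * w) (t := (t * z) ^ n)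
    (fun k hk => by rw [hw k (hKM hk)]; exact hinv k hk)
    (fun k hk => by rw [hw k (hKM hk), hzn k (hKE hk), hact k hk])
    (fun i hi => by
      rw [hsw] at hi
      have hi := (hw0 i).1 (hw1 i ((mul_mem_cancel_left (zpow_mem hsM i)).1 (hKM hi)))
      rw [htz, ht0 _ (hi.mul_left _), (hz0 i).2 hi, one_mul])
    (fun i hi => by
      rw [htz] at hi
      have hi := (hz0 i).1 (hz1 _ ((mul_mem_cancel_left (zpow_mem htE _)).1 (hKE hi)))
      rw [hsw, hs0 _ hi, (hw0 i).2 hi, one_mul])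
  refine ⟨t * z, h, fun x hx => hz x (Subgroup.subset_closure (Or.inl (Or.inr hx))),
    fun k hk => hh k (Subgroup.subset_closure hk), fun x hx => ?_⟩
  rw [← hw x (Subgroup.subset_closure (Or.inl (Or.inr hx))), ← hc]
  group

/-! ### Universal automorphisms and their powers -/

/-- An automorphism which is locally inner and into which every finite extension of its finite
restrictions embeds. -/
structure IsUniversalAut (g : MulAut H) : Prop where
  exists_conj : ∀ F : Finset H, ∃ s : H, g s = s ∧ ∀ x ∈ F, g x = s * x * s⁻¹
  exists_extension : ∀ (F E : Finset H) (s : H), (∀ x ∈ F, g x ∈ F ∧ g x = s * x * s⁻¹) →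
    ∃ h : H, (∀ x ∈ F, h * x * h⁻¹ = x) ∧ ∀ m ∈ E, g (h * m * h⁻¹) = h * (s * m * s⁻¹) * h⁻¹

theorem IsLocallyFiniteGroup.exists_finset_closed (hH : IsLocallyFiniteGroup H) (F : Finset H)
    (s : H) : ∃ F' : Finset H, F ⊆ F' ∧ s ∈ F' ∧ ∀ x ∈ F', s * x * s⁻¹ ∈ F' := by
  have hfin := hH.finite_closure (S := (F : Set H) ∪ {s}) (by simp)
  have hs : s ∈ closure ((F : Set H) ∪ {s}) := Subgroup.subset_closure (Or.inr rfl)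
  refine ⟨(Set.toFinite (closure ((F : Set H) ∪ {s}) : Set H)).toFinset, fun x hx => ?_, ?_,
    fun x hx => ?_⟩
  · rw [Set.Finite.mem_toFinset]
    exact Subgroup.subset_closure (Or.inl hx)
  · simpa using hs
  · rw [Set.Finite.mem_toFinset] at hx ⊢
    exact mul_mem (mul_mem hs hx) (inv_mem hs)

/-- Since `g` fixes `s`, it acts as conjugation by `s` on the whole finite group generated by `F`
and `s`. -/
theorem IsUniversalAut.exists_invariant (hH : IsLocallyFiniteGroup H) {g : MulAut H}
    (hg : IsUniversalAut g) (F : Finset H) :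
    ∃ (F' : Finset H) (s : H), F ⊆ F' ∧ g s = s ∧ ∀ x ∈ F', g x ∈ F' ∧ g x = s * x * s⁻¹ := by
  obtain ⟨s, hs, hF⟩ := hg.exists_conj F
  have hfin := hH.finite_closure (S := (F : Set H) ∪ {s}) (by simp)
  have hsc : s ∈ closure ((F : Set H) ∪ {s}) := Subgroup.subset_closure (Or.inr rfl)
  refine ⟨(Set.toFinite (closure ((F : Set H) ∪ {s}) : Set H)).toFinset, s, fun x hx => ?_, hs,
    fun x hx => ?_⟩
  · rw [Set.Finite.mem_toFinset]
    exact Subgroup.subset_closure (Or.inl hx)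
  · rw [Set.Finite.mem_toFinset] at hx ⊢
    have h : g x = s * x * s⁻¹ := MonoidHom.eqOn_closure (f := g.toMonoidHom)
      (g := (MulAut.conj s).toMonoidHom) (s := (F : Set H) ∪ {s}) (by
        rintro y (hy | rfl)
        · exact hF y hy
        · simp [hs]) hx
    rw [h]
    exact ⟨mul_mem (mul_mem hsc hx) (inv_mem hsc), rfl⟩

theorem MulAut.pow_apply_eq_conj {g : MulAut H} {s : H} {F : Set H}
    (hF : ∀ x ∈ F, g x ∈ F ∧ g x = s * x * s⁻¹) (n : ℕ) :
    ∀ x ∈ F, (g ^ n) x ∈ F ∧ (g ^ n) x = s ^ n * x * (s ^ n)⁻¹ := by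
  induction n with
  | zero => simp
  | succ n ih =>
    intro x hx
    obtain ⟨h1, h2⟩ := ih x hx
    obtain ⟨h3, h4⟩ := hF _ h1
    rw [pow_succ', MulAut.mul_apply]
    exact ⟨h3, by rw [h4, h2, pow_succ']; group⟩

theorem IsUniversalAut.pow (hH : IsHallUniversalGroup H) {g : MulAut H} (hg : IsUniversalAut g)
    {n : ℕ} (hn : 0 < n) : IsUniversalAut (g ^ n) where
  exists_conj F := by
    obtain ⟨F', s, hF, hs, hF'⟩ := hg.exists_invariant hH.locallyFinite F
    refine ⟨s ^ n, ?_, fun x hx => (MulAut.pow_apply_eq_conj hF' n x (hF hx)).2⟩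
    have := MulAut.pow_apply_eq_conj (g := g) (s := s) (F := {s}) (by simp [hs]) n s rfl
    rw [map_pow, Set.mem_singleton_iff.1 this.1]
  exists_extension F E s hF := by
    classical
    obtain ⟨K, t, hFK, -, hK⟩ := hg.exists_invariant hH.locallyFinite F
    have hKn := MulAut.pow_apply_eq_conj hK n
    obtain ⟨t', h₁, ht', hh₁, hE⟩ := hH.exists_amalgam_root F K E (s := s) (t := t) hn
      (fun k hk => (hF k hk).2 ▸ (hF k hk).1)
      (fun k hk => (hF k hk).2.symm.trans (hKn k (hFK hk)).2)
    -- Closing under conjugation by `t'` lets the one-step identity for `g` be iterated `n` times.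
    obtain ⟨M, hM, -, hMt⟩ := hH.locallyFinite.exists_finset_closed
      (E.image fun m => h₁ * m * h₁⁻¹) t'
    obtain ⟨h₂, hh₂, hgM⟩ := hg.exists_extension K M t'
      (fun x hx => ⟨(hK x hx).1, (hK x hx).2.trans (ht' x hx).symm⟩)
    have key : ∀ i : ℕ, ∀ y ∈ M, t' ^ i * y * (t' ^ i)⁻¹ ∈ M ∧
        (g ^ i) (h₂ * y * h₂⁻¹) = h₂ * (t' ^ i * y * (t' ^ i)⁻¹) * h₂⁻¹ := by
      intro i
      induction i with
      | zero => simp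
      | succ i ih =>
        intro y hy
        obtain ⟨h3, h4⟩ := ih y hy
        have h5 : t' ^ (i + 1) * y * (t' ^ (i + 1))⁻¹ = t' * (t' ^ i * y * (t' ^ i)⁻¹) * t'⁻¹ := by
          rw [pow_succ']; group
        rw [h5, pow_succ' g, MulAut.mul_apply, h4, hgM _ h3]
        exact ⟨hMt _ h3, rfl⟩
    refine ⟨h₂ * h₁, fun x hx => ?_, fun m hm => ?_⟩
    · rw [show h₂ * h₁ * x * (h₂ * h₁)⁻¹ = h₂ * (h₁ * x * h₁⁻¹) * h₂⁻¹ by group, hh₁ x hx,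
        hh₂ x (hFK hx)]
    · have hm' := hM (Finset.mem_image_of_mem _ hm)
      rw [show h₂ * h₁ * m * (h₂ * h₁)⁻¹ = h₂ * (h₁ * m * h₁⁻¹) * h₂⁻¹ by group,
        (key n _ hm').2, hE m hm]
      group

/-! ### Back-and-forth -/

/-- Conjugation by `c` intertwines `g` and `g'` on the `g`-invariant finite set `F`. -/
structure Intertwines (g g' : MulAut H) (F : Finset H) (c : H) : Prop where
  invariant : ∀ x ∈ F, g x ∈ F
  map_eq : ∀ x ∈ F, c * g x * c⁻¹ = g' (c * x * c⁻¹)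

theorem Intertwines.symm [DecidableEq H] {g g' : MulAut H} {F : Finset H} {c : H}
    (h : Intertwines g g' F c) : Intertwines g' g (F.image fun x => c * x * c⁻¹) c⁻¹ := by
  constructor
  · intro x hx
    obtain ⟨y, hy, rfl⟩ := Finset.mem_image.1 hx
    exact Finset.mem_image.2 ⟨g y, h.invariant y hy, h.map_eq y hy⟩
  · intro x hx
    obtain ⟨y, hy, rfl⟩ := Finset.mem_image.1 hx
    rw [← h.map_eq y hy, show c⁻¹ * (c * y * c⁻¹) * c⁻¹⁻¹ = y by group]
    group

theorem Intertwines.forth (hH : IsLocallyFiniteGroup H) {g g' : MulAut H}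
    (hg : IsUniversalAut g) (hg' : IsUniversalAut g') {F : Finset H} {c : H}
    (h : Intertwines g g' F c) (x : H) : ∃ (F' : Finset H) (c' : H), F ⊆ F' ∧ x ∈ F' ∧
      Intertwines g g' F' c' ∧ ∀ y ∈ F, c' * y * c'⁻¹ = c * y * c⁻¹ := by
  classical
  -- The action of `g` on `F'` is carried over by `c`, and the extension property of `g'` realises
  -- it over the image of `F`.
  obtain ⟨F', s, hF, -, hs⟩ := hg.exists_invariant hH (insert x F)
  have hF := Finset.insert_subset_iff.1 hF
  obtain ⟨u, hu, hE⟩ := hg'.exists_extension (F.image fun x => c * x * c⁻¹)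
    (F'.image fun x => c * x * c⁻¹) (c * s * c⁻¹) (by
      intro y hy
      refine ⟨h.symm.invariant y hy, ?_⟩
      obtain ⟨z, hz, rfl⟩ := Finset.mem_image.1 hy
      rw [← h.map_eq z hz, (hs z (hF.2 hz)).2]
      group)
  refine ⟨F', u * c, hF.2, hF.1, ⟨fun y hy => (hs y hy).1, fun y hy => ?_⟩, fun y hy => ?_⟩
  · have := hE _ (Finset.mem_image_of_mem _ hy)
    rw [show u * c * y * (u * c)⁻¹ = u * (c * y * c⁻¹) * u⁻¹ by group, this, (hs y hy).2]
    group
  · rw [← hu _ (Finset.mem_image_of_mem _ hy)]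
    group

theorem Intertwines.back_and_forth (hH : IsLocallyFiniteGroup H) {g g' : MulAut H}
    (hg : IsUniversalAut g) (hg' : IsUniversalAut g') {F : Finset H} {c : H}
    (h : Intertwines g g' F c) (x : H) : ∃ (F' : Finset H) (c' : H), F ⊆ F' ∧ x ∈ F' ∧
      (∃ y ∈ F', c' * y * c'⁻¹ = x) ∧
      Intertwines g g' F' c' ∧ ∀ y ∈ F, c' * y * c'⁻¹ = c * y * c⁻¹ := by
  classical
  obtain ⟨F₁, c₁, hF₁, hx₁, h₁, hc₁⟩ := h.forth hH hg hg' x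
  obtain ⟨F₂, c₂, hF₂, hx₂, h₂, hc₂⟩ := h₁.symm.forth hH hg' hg x
  have hc : ∀ y ∈ F₁, c₂⁻¹ * y * c₂⁻¹⁻¹ = c₁ * y * c₁⁻¹ := fun y hy => by
    have := hc₂ _ (Finset.mem_image_of_mem _ hy)
    rw [show c₁⁻¹ * (c₁ * y * c₁⁻¹) * c₁⁻¹⁻¹ = y by group] at this
    nth_rw 1 [← this]
    group
  have hF : F₁ ⊆ F₂.image fun x => c₂ * x * c₂⁻¹ := fun y hy =>
    Finset.mem_image.2 ⟨_, hF₂ (Finset.mem_image_of_mem _ hy), by rw [← hc y hy]; group⟩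
  exact ⟨F₂.image fun x => c₂ * x * c₂⁻¹, c₂⁻¹, hF₁.trans hF, hF hx₁,
    ⟨_, Finset.mem_image_of_mem _ hx₂, by group⟩, h₂.symm,
    fun y hy => (hc y (hF₁ hy)).trans (hc₁ y hy)⟩

theorem IsUniversalAut.isConj [Countable H] (hH : IsLocallyFiniteGroup H) {g g' : MulAut H}
    (hg : IsUniversalAut g) (hg' : IsUniversalAut g') : IsConj g g' := by
  classical
  obtain ⟨e, he⟩ := exists_surjective_nat H
  let S := {p : Finset H × H // Intertwines g g' p.1 p.2}
  have step : ∀ (p : S) (x : H), ∃ q : S, p.1.1 ⊆ q.1.1 ∧ x ∈ q.1.1 ∧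
      (∃ y ∈ q.1.1, q.1.2 * y * q.1.2⁻¹ = x) ∧
      ∀ y ∈ p.1.1, q.1.2 * y * q.1.2⁻¹ = p.1.2 * y * p.1.2⁻¹ := fun p x => by
    obtain ⟨F, c, h1, h2, h3, h4, h5⟩ := p.2.back_and_forth hH hg hg' x
    exact ⟨⟨(F, c), h4⟩, h1, h2, h3, h5⟩
  choose next hsub hmem hsurj hagree using step
  let p : ℕ → S := fun i => Nat.rec ⟨(∅, 1), ⟨by simp, by simp⟩⟩ (fun i q => next q (e i)) i
  have hp : ∀ i, p (i + 1) = next (p i) (e i) := fun i => rfl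
  have hmono : ∀ i j, i ≤ j → (p i).1.1 ⊆ (p j).1.1 ∧
      ∀ y ∈ (p i).1.1, (p j).1.2 * y * (p j).1.2⁻¹ = (p i).1.2 * y * (p i).1.2⁻¹ := by
    intro i j hij
    induction j, hij using Nat.le_induction with
    | base => exact ⟨subset_rfl, fun _ _ => rfl⟩
    | succ j _ ih =>
      refine ⟨ih.1.trans (hsub _ _), fun y hy => ?_⟩
      rw [hp, hagree _ _ y (ih.1 hy), ih.2 y hy]
  have hex : ∀ x, ∃ i, x ∈ (p i).1.1 := fun x => by
    obtain ⟨i, rfl⟩ := he x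
    exact ⟨i + 1, hmem _ _⟩
  choose ι hι using hex
  let a : H → H := fun x => (p (ι x)).1.2 * x * (p (ι x)).1.2⁻¹
  have ha : ∀ i, ∀ x ∈ (p i).1.1, a x = (p i).1.2 * x * (p i).1.2⁻¹ := fun i x hx => by
    rcases le_total i (ι x) with h | h
    · exact (hmono _ _ h).2 x hx
    · exact ((hmono _ _ h).2 x (hι x)).symm
  have hle : ∀ {i j} {x}, i ≤ j → x ∈ (p i).1.1 → x ∈ (p j).1.1 := fun h hx => (hmono _ _ h).1 hx
  have hmul : ∀ x y, a (x * y) = a x * a y := fun x y => by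
    let N := max (ι (x * y)) (max (ι x) (ι y))
    rw [ha N _ (hle (le_max_left _ _) (hι _)),
      ha N x (hle (le_max_of_le_right (le_max_left _ _)) (hι _)),
      ha N y (hle (le_max_of_le_right (le_max_right _ _)) (hι _))]
    group
  have hinj : Function.Injective a := fun x y h => by
    rw [ha (max (ι x) (ι y)) x (hle (le_max_left _ _) (hι _)),
      ha (max (ι x) (ι y)) y (hle (le_max_right _ _) (hι _))] at h
    exact mul_left_cancel (mul_right_cancel h)
  have hsurj' : Function.Surjective a := fun x => by
    obtain ⟨i, rfl⟩ := he x
    obtain ⟨y, hy, h⟩ := hsurj (p i) (e i)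
    exact ⟨y, (ha (i + 1) y hy).trans h⟩
  let A : MulAut H := MulEquiv.ofBijective (MonoidHom.mk' a hmul) ⟨hinj, hsurj'⟩
  refine isConj_iff.2 ⟨A, mul_inv_eq_iff_eq_mul.2 (MulEquiv.ext fun x => ?_)⟩
  change a (g x) = g' (a x)
  have h := (p (ι x)).2
  rw [ha _ _ (h.invariant x (hι x)), ha _ x (hι x), h.map_eq x (hι x)]

/-! ### Topology of the automorphism group -/

theorem mem_of_isOpen_autTopology {U : Set (MulAut H)} (hU : @IsOpen _ (autTopology H) U)
    {g : MulAut H} (hg : g ∈ U) :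
    ∃ F : Finset H, ∀ g' : MulAut H, (∀ x ∈ F, g' x = g x) → g' ∈ U := by
  let : TopologicalSpace H := ⊥
  obtain ⟨V, hV, rfl⟩ := isOpen_induced_iff.1 hU
  obtain ⟨F, u, hu, hFu⟩ := isOpen_pi_iff.1 hV _ hg
  refine ⟨F, fun g' h => hFu fun x hx => ?_⟩
  change g' x ∈ u x
  rw [h x hx]
  exact (hu x hx).2

theorem isOpen_autTopology_of_forall {U : Set (MulAut H)}
    (h : ∀ g ∈ U, ∃ F : Finset H, ∀ g' : MulAut H, (∀ x ∈ F, g' x = g x) → g' ∈ U) :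
    @IsOpen _ (autTopology H) U := by
  let : TopologicalSpace H := ⊥
  have : DiscreteTopology H := ⟨rfl⟩
  let : TopologicalSpace (MulAut H) := autTopology H
  refine isOpen_iff_forall_mem_open.2 fun g hg => ?_
  obtain ⟨F, hF⟩ := h g hg
  refine ⟨(fun (g : MulAut H) (x : H) => g x) ⁻¹' ((F : Set H).pi fun x => {g x}),
    fun g' h' => hF g' h', ?_, fun x _ => rfl⟩
  exact isOpen_induced (isOpen_set_pi F.finite_toSet fun x _ => isOpen_discrete _)

theorem dense_autTopology_of_forall {U : Set (MulAut H)}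
    (h : ∀ (g : MulAut H) (F : Finset H), ∃ g' ∈ U, ∀ x ∈ F, g' x = g x) :
    @Dense _ (autTopology H) U := by
  let : TopologicalSpace (MulAut H) := autTopology H
  refine dense_iff_inter_open.2 fun V hV ⟨g, hg⟩ => ?_
  obtain ⟨F, hF⟩ := mem_of_isOpen_autTopology hV hg
  obtain ⟨g', hg', hgF⟩ := h g F
  exact ⟨g', hF g' hgF, hg'⟩

/-- Recording the inverse alongside `g` makes bijectivity a closed condition, so the group embeds as
a closed subspace of a completely metrizable space. -/
theorem baireSpace_autTopology [Countable H] : @BaireSpace (MulAut H) (autTopology H) := by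
  let : TopologicalSpace H := ⊥
  have : DiscreteTopology H := ⟨rfl⟩
  let : TopologicalSpace (MulAut H) := autTopology H
  let f : MulAut H → (H → H) × (H → H) := fun g => (fun x => g x, fun x => g.symm x)
  have hf₁ : Topology.IsInducing fun (g : MulAut H) (x : H) => g x := ⟨rfl⟩
  have hf₂ : Continuous fun (g : MulAut H) (x : H) => g.symm x := by
    refine continuous_pi fun x => continuous_discrete_rng.2 fun y => ?_
    refine isOpen_autTopology_of_forall fun g hg => ⟨{y}, fun g' h' => ?_⟩
    have hg : g.symm x = y := hg
    have h' := h' y (Finset.mem_singleton_self y)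
    change g'.symm x = y
    rw [MulEquiv.symm_apply_eq, h', ← hg, MulEquiv.apply_symm_apply]
  have hind : Topology.IsInducing f :=
    .of_comp (hf₁.continuous.prodMk hf₂) continuous_fst hf₁
  have hinj : Function.Injective f := fun g g' h =>
    MulEquiv.ext fun x => congrFun (congrArg Prod.fst h) x
  have hrange : Set.range f = {p | (∀ x, p.1 (p.2 x) = x) ∧ (∀ x, p.2 (p.1 x) = x) ∧
      ∀ x y, p.1 (x * y) = p.1 x * p.1 y} := by
    ext p
    constructor
    · rintro ⟨g, rfl⟩
      exact ⟨g.apply_symm_apply, g.symm_apply_apply, map_mul g⟩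
    · rintro ⟨h₁, h₂, h₃⟩
      exact ⟨{ toFun := p.1, invFun := p.2, left_inv := h₂, right_inv := h₁, map_mul' := h₃ }, rfl⟩
  have hev : Continuous fun q : (H → H) × H => q.1 q.2 := by
    refine continuous_discrete_rng.2 fun y => isOpen_iff_forall_mem_open.2 fun q hq => ?_
    refine ⟨((fun a : H → H => a q.2) ⁻¹' {y}) ×ˢ {q.2}, ?_,
      (isOpen_discrete _).preimage (continuous_apply _) |>.prod (isOpen_discrete _), hq, rfl⟩
    rintro ⟨a, x⟩ ⟨ha, rfl⟩
    exact ha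
  have hclosed : IsClosed (Set.range f) := by
    have h₁ : ∀ x : H, Continuous fun p : (H → H) × (H → H) => p.1 x := fun x =>
      (continuous_apply x).comp continuous_fst
    have h₂ : ∀ x : H, Continuous fun p : (H → H) × (H → H) => p.2 x := fun x =>
      (continuous_apply x).comp continuous_snd
    rw [hrange]
    simp only [Set.ofPred_and, Set.ofPred_forall]
    refine .inter (isClosed_iInter fun x => ?_) (.inter (isClosed_iInter fun x => ?_)
      (isClosed_iInter fun x => isClosed_iInter fun y => ?_))
    · exact isClosed_eq (hev.comp (continuous_fst.prodMk (h₂ x))) continuous_const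
    · exact isClosed_eq (hev.comp (continuous_snd.prodMk (h₁ x))) continuous_const
    · exact isClosed_eq (h₁ _) ((h₁ x).mul (h₁ y))
  have : TopologicalSpace.IsCompletelyMetrizableSpace (MulAut H) :=
    Topology.IsClosedEmbedding.IsCompletelyMetrizableSpace ⟨⟨hind, hinj⟩, hclosed⟩
  infer_instance

/-! ### Universality is comeager -/

theorem IsHallUniversalGroup.residual_exists_conj (hH : IsHallUniversalGroup H) (F : Finset H) :
    {g : MulAut H | ∃ s : H, g s = s ∧ ∀ x ∈ F, g x = s * x * s⁻¹} ∈
      @residual (MulAut H) (autTopology H) := by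
  classical
  let : TopologicalSpace (MulAut H) := autTopology H
  refine residual_of_dense_open (isOpen_autTopology_of_forall ?_) (dense_autTopology_of_forall ?_)
  · rintro g ⟨s, hs, hF⟩
    refine ⟨insert s F, fun g' h' => ⟨s, ?_, fun x hx => ?_⟩⟩
    · rw [h' s (Finset.mem_insert_self s F), hs]
    · rw [h' x (Finset.mem_insert_of_mem hx), hF x hx]
  · intro g E
    obtain ⟨s, hs⟩ := hH.exists_conj_eq_on g E
    exact ⟨MulAut.conj s, ⟨s, by simp, fun x _ => by simp⟩, fun x hx => by simp [hs x hx]⟩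

theorem IsHallUniversalGroup.residual_exists_extension (hH : IsHallUniversalGroup H)
    (F E : Finset H) (s : H) :
    {g : MulAut H | (∀ x ∈ F, g x ∈ F ∧ g x = s * x * s⁻¹) →
      ∃ h : H, (∀ x ∈ F, h * x * h⁻¹ = x) ∧
        ∀ m ∈ E, g (h * m * h⁻¹) = h * (s * m * s⁻¹) * h⁻¹} ∈
      @residual (MulAut H) (autTopology H) := by
  classical
  let : TopologicalSpace (MulAut H) := autTopology H
  refine residual_of_dense_open (isOpen_autTopology_of_forall ?_) (dense_autTopology_of_forall ?_)
  · intro g hg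
    by_cases hF : ∀ x ∈ F, g x ∈ F ∧ g x = s * x * s⁻¹
    · obtain ⟨h, hh, hE⟩ := hg hF
      refine ⟨E.image fun m => h * m * h⁻¹, fun g' h' _ => ⟨h, hh, fun m hm => ?_⟩⟩
      rw [h' _ (Finset.mem_image_of_mem _ hm), hE m hm]
    · refine ⟨F, fun g' h' h'' => (hF fun x hx => ?_).elim⟩
      rw [← h' x hx]
      exact h'' x hx
  · intro g K
    by_cases hF : ∀ x ∈ F, g x ∈ F ∧ g x = s * x * s⁻¹
    · obtain ⟨t, ht⟩ := hH.exists_conj_eq_on g (F ∪ K)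
      -- Density is plain amalgamation, the case `n = 1`: the inner automorphism by `t'` still
      -- agrees with `g` on `K` and realises the extension `s`.
      obtain ⟨t', h, ht', hh, hE⟩ := hH.exists_amalgam_root F K E (s := s) (t := t) one_pos
        (fun x hx => (hF x hx).2 ▸ (hF x hx).1) (fun x hx => by
          rw [pow_one, ← (hF x hx).2, ht x (Finset.mem_union_left _ hx)])
      refine ⟨MulAut.conj t', fun _ => ⟨h, hh, fun m hm => ?_⟩, fun x hx => ?_⟩
      · rw [MulAut.conj_apply, ← hE m hm, pow_one]
      · rw [MulAut.conj_apply, ht' x hx, ht x (Finset.mem_union_right _ hx)]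
    · exact ⟨g, fun h => (hF h).elim, fun _ _ => rfl⟩

theorem IsHallUniversalGroup.residual_isUniversalAut (hH : IsHallUniversalGroup H) :
    {g : MulAut H | IsUniversalAut g} ∈ @residual (MulAut H) (autTopology H) := by
  let : TopologicalSpace (MulAut H) := autTopology H
  have := hH.countable
  have h₁ := eventually_countable_forall.2 hH.residual_exists_conj
  have h₂ := eventually_countable_forall.2 fun F => eventually_countable_forall.2 fun E =>
    eventually_countable_forall.2 fun s => hH.residual_exists_extension F E s
  filter_upwards [h₁, h₂] with g hg₁ hg₂
  exact ⟨hg₁, hg₂⟩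

end

theorem mainTheorem4 {H : Type*} [Group H] (hH : IsHallUniversalGroup H)
    (g : MulAut H) (hg : IsGenericAut g) (n : ℕ) (hn : 1 ≤ n) :
    IsConj g (g ^ n) := by
  let : TopologicalSpace (MulAut H) := autTopology H
  have := hH.countable
  have : BaireSpace (MulAut H) := baireSpace_autTopology
  obtain ⟨g', hgg', hg'⟩ :=
    (dense_of_mem_residual (Filter.inter_mem hg hH.residual_isUniversalAut)).nonempty
  have hpow : IsConj (g' ^ n) (g ^ n) := by
    obtain ⟨c, rfl⟩ := isConj_iff.1 hgg'
    rw [conj_pow]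
    exact (isConj_iff.2 ⟨c, rfl⟩).symm
  exact (hgg'.trans (hg'.isConj hH.locallyFinite (hg'.pow hH hn))).trans hpow
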